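/- Let $f:\mathbb{R}\to\mathbb{R}$ be twice differentiable with $f>0$, $f'\ge 0$, $f''>0$ on $\mathbb{R}$ and $\lim_{u\to\infty} f(u)/u=\infty$, and let $\alpha<0$, $\lambda>0$, $L>0$. Set $\gamma^*=\sqrt{\lambda}/\alpha$, let $F(u)=\int_{-\infty}^u f(t)\,dt$ if $f$ is integrable at $-\infty$ and $F(u)=\int_0^u f(t)\,dt$ otherwise, and put $s_0=F(0)$. For $C>s_0$ let $v_1^+(C)$ be the largest $v$ with $F(\gamma^* v)=C-\frac{v^2}{2}$, and let $$L_1(C)=2\int_0^{v_1^+(C)}\frac{dv}{\sqrt{\lambda}\,f\!\left(F^{-1}\!\left(C-\frac{v^2}{2}\right)\right)} .$$ Suppose that $L_1$ is strictly decreasing on $(s_0,\infty)$. Then the Robin problem $$u''(x)+\lambda f(u(x))=0 \text{ in } (0,L),\qquad u'(0)=\alpha u(0),\quad u'(L)=-\alpha u(L)$$ has at most two solutions that are monotone increasing on $[0,L]$, and at most two solutions that are monotone decreasing on $[0,L]$. (Such solutions are never symmetric about $L/2$.) -/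

import Mathlib

open Set MeasureTheory

noncomputable section

namespace RobinBVP

/-- `u` is a classical solution of `u'' + lam * f u = 0` in `(0, L)`, with
`u' 0 = α * u 0` and `u' L = -α * u L` (one-sided derivatives at the endpoints). -/
structure IsSolution (f : ℝ → ℝ) (α lam L : ℝ) (u : ℝ → ℝ) : Prop where
  contDiffOn : ContDiffOn ℝ 1 u (Icc 0 L)
  ode : ∀ x ∈ Ioo 0 L, HasDerivAt (deriv u) (-(lam * f (u x))) x
  left : derivWithin u (Icc 0 L) 0 = α * u 0
  right : derivWithin u (Icc 0 L) L = -α * u L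

/-- The set of solutions with property `p`, as functions on `[0, L]`. -/
def solutionsOn (f : ℝ → ℝ) (α lam L : ℝ) (p : (ℝ → ℝ) → Prop) : Set (Icc (0 : ℝ) L → ℝ) :=
  (Icc (0 : ℝ) L).domRestrict '' {u | IsSolution f α lam L u ∧ p u}

open Classical in
/-- The primitive of `f`: `∫_{-∞}^u f` if `f` is integrable at `-∞`, `∫_0^u f` otherwise. -/
def F (f : ℝ → ℝ) (u : ℝ) : ℝ :=
  if IntegrableOn f (Iic 0) then ∫ t in Iic u, f t else ∫ t in (0 : ℝ)..u, f t

/-- `s₀ = F 0`. -/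
def s₀ (f : ℝ → ℝ) : ℝ := F f 0

/-- `F⁻¹`, only used on the range of the strictly increasing function `F f`. -/
def Finv (f : ℝ → ℝ) : ℝ → ℝ := Function.invFun (F f)

/-- The curve `u = F⁻¹ (C - v² / 2)` in the `(v, u)` phase plane. -/
def curveK (f : ℝ → ℝ) (C : ℝ) : Set (ℝ × ℝ) := {P | F f P.2 = C - P.1 ^ 2 / 2}

/-- The line `u = γ v` with `γ = √lam / α`, which encodes the boundary condition at `0`. -/
def linePlus (α lam : ℝ) : Set (ℝ × ℝ) := {P | P.2 = (√lam / α) * P.1}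

/-- The `v`-coordinate of the intersection point of the curve and the line with the larger `v`. -/
def v₁ (f : ℝ → ℝ) (α lam C : ℝ) : ℝ := sSup (Prod.fst '' (curveK f C ∩ linePlus α lam))

/-- The length of the interval on which the symmetric solution with energy `C` lives whose
trajectory runs on the curve from `v = v₁` to `v = -v₁`. -/
def L₁ (f : ℝ → ℝ) (α lam C : ℝ) : ℝ :=
  2 * ∫ v in (0 : ℝ)..v₁ f α lam C, 1 / (√lam * f (Finv f (C - v ^ 2 / 2)))

end RobinBVP

end

open Set MeasureTheory

noncomputable section

namespace RobinBVP

/-! Put κ = √λ, v = u'/κ, γ = κ/α < 0. Solutions run on level curves F(u) + v²/2 = C, from the ray u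
= γv to the ray u = -γv; increasing ones stay in v ≥ 0, and x ↦ L - x turns decreasing ones into
increasing ones.

In v ≥ 0 the energy determines the trajectory (`eqOn_of_energy_eq`), and C ≥ F(0). The level C =
F(0) gives at most one solution. For C > F(0) the rescaled length is T(C) = `rayTime` γ - `rayTime`
(-γ), and `L₁` is a positive multiple of `rayTime` γ. It remains to show that T is strictly
decreasing, which gives at most one more solution.

By `hasDerivAt_rayTime`, T' is the integral of `rateDensity` over the arc between the rays. Its sign
is that of u(f(u) - u f'(u)): negative for u < 0, positive at most on some interval 0 < u < ρ,
nonpositive beyond. To control the bad part, compare with the lower curve of energy F(ρ), which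
meets v = 0 at u = ρ: there the density has nonpositive integral down to the ray γ, because `L₁`
decreases. Matching points of equal u, `rateDensity_le` transfers this sign to the upper curve, and
`integral_rateDensity_neg` adds the remaining arcs. -/

/-- A positive, nondecreasing, strictly convex nonlinearity `f`, a primitive `F` of `f` and a left
inverse `U` of `F`. -/
structure PhasePlane (f F U : ℝ → ℝ) : Prop where
  differentiable : Differentiable ℝ f
  differentiable_deriv : Differentiable ℝ (deriv f)
  pos : ∀ u, 0 < f u
  deriv_nonneg : ∀ u, 0 ≤ deriv f u
  deriv_deriv_pos : ∀ u, 0 < deriv (deriv f) u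
  hasDerivAt_primitive : ∀ u, HasDerivAt F (f u) u
  left_inv : ∀ u, U (F u) = u

/-- The intercept `f u - u f' u` of the tangent to `f` at `u`. -/
def intercept (f : ℝ → ℝ) (u : ℝ) : ℝ := f u - u * deriv f u

/-- The energy at the point `(q, τ q)` of the ray of slope `τ`. -/
def rayEnergy (F : ℝ → ℝ) (τ q : ℝ) : ℝ := F (τ * q) + q ^ 2 / 2

open Classical in
/-- The positive parameter of a point with energy `C` on the ray of slope `τ`. -/
def rayRoot (F : ℝ → ℝ) (τ C : ℝ) : ℝ :=
  if h : ∃ q, 0 < q ∧ rayEnergy F τ q = C then h.choose else 0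

/-- The density of the derivative with respect to the energy of the time spent between rays. -/
def rateDensity (f U : ℝ → ℝ) (C w : ℝ) : ℝ :=
  intercept f (U (C - w ^ 2 / 2)) * U (C - w ^ 2 / 2) /
    (f (U (C - w ^ 2 / 2)) * (w ^ 2 + U (C - w ^ 2 / 2) * f (U (C - w ^ 2 / 2))) ^ 2)

/-- The rescaled time needed to run on the curve of energy `C` from the ray of slope `τ`
to the axis `v = 0`. -/
def rayTime (f F U : ℝ → ℝ) (τ C : ℝ) : ℝ :=
  ∫ w in (0 : ℝ)..rayRoot F τ C, 1 / f (U (C - w ^ 2 / 2))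

namespace PhasePlane

variable {f F U : ℝ → ℝ} (h : PhasePlane f F U)

include h

/-! ### The primitive and its inverse -/

theorem monotone : Monotone f := monotone_of_deriv_nonneg h.differentiable h.deriv_nonneg

theorem continuous : Continuous f := h.differentiable.continuous

theorem continuous_deriv : Continuous (deriv f) := h.differentiable_deriv.continuous

theorem continuous_intercept : Continuous (intercept f) :=
  h.continuous.sub (continuous_id.mul h.continuous_deriv)

theorem strictMono_primitive : StrictMono F := by
  apply strictMono_of_deriv_pos
  intro u
  rw [(h.hasDerivAt_primitive u).deriv]
  exact h.pos u

theorem continuous_primitive : Continuous F :=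
  continuous_iff_continuousAt.2 fun u => (h.hasDerivAt_primitive u).continuousAt

theorem primitive_lower_bound (u : ℝ) : F 0 + f 0 * u ≤ F u := by
  have hd : ∀ x, HasDerivAt (fun x => F x - f 0 * x) (f x - f 0) x := fun x => by
    exact ((h.hasDerivAt_primitive x).fun_sub ((hasDerivAt_id' x).const_mul (f 0))).congr_deriv
      (by ring)
  have hc : Continuous (fun x => F x - f 0 * x) :=
    h.continuous_primitive.sub (continuous_const.mul continuous_id)
  rcases le_total 0 u with hu | hu
  · have := monotoneOn_of_deriv_nonneg (convex_Ici (0 : ℝ)) hc.continuousOn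
      (fun x _ => (hd x).differentiableAt.differentiableWithinAt) (fun x hx => by
        rw [interior_Ici] at hx
        rw [(hd x).deriv]
        exact sub_nonneg.2 (h.monotone hx.le)) self_mem_Ici hu hu
    simp only at this
    linarith
  · have := antitoneOn_of_deriv_nonpos (convex_Iic (0 : ℝ)) hc.continuousOn
      (fun x _ => (hd x).differentiableAt.differentiableWithinAt) (fun x hx => by
        rw [interior_Iic] at hx
        rw [(hd x).deriv]
        exact sub_nonpos.2 (h.monotone hx.le)) hu self_mem_Iic hu
    simp only at this
    linarith

/-- The tangent to F at 0 has positive slope and lies below F, so every value above F u₀ is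
attained. Off the range of F nothing is known about U, hence the lower bound on s. -/
theorem right_inv {u₀ s : ℝ} (hs : F u₀ ≤ s) : F (U s) = s := by
  have hf0 := h.pos 0
  obtain ⟨u₁, hu₁, hs₁⟩ : ∃ u₁, u₀ ≤ u₁ ∧ s ≤ F u₁ := by
    refine ⟨max u₀ ((s - F 0) / f 0), le_max_left _ _, ?_⟩
    have h1 := h.primitive_lower_bound ((s - F 0) / f 0)
    rw [mul_div_cancel₀ _ hf0.ne'] at h1
    have h2 := h.strictMono_primitive.monotone (le_max_right u₀ ((s - F 0) / f 0))
    linarith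
  obtain ⟨u, -, rfl⟩ := intermediate_value_Icc hu₁ h.continuous_primitive.continuousOn ⟨hs, hs₁⟩
  rw [h.left_inv]

theorem isOpen_range : IsOpen (range F) := by
  rw [isOpen_iff_mem_nhds]
  rintro _ ⟨u, rfl⟩
  refine Filter.mem_of_superset (Ioi_mem_nhds (h.strictMono_primitive (sub_one_lt u))) ?_
  intro s hs
  exact ⟨U s, h.right_inv (le_of_lt hs)⟩

theorem hasDerivAt_inverse (u : ℝ) : HasDerivAt U (f u)⁻¹ (F u) := by
  have hmem : range F ∈ nhds (F u) := h.isOpen_range.mem_nhds ⟨u, rfl⟩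
  have hmono : StrictMonoOn U (range F) := by
    rintro _ ⟨a, rfl⟩ _ ⟨b, rfl⟩ hab
    rw [h.left_inv, h.left_inv]
    exact h.strictMono_primitive.lt_iff_lt.1 hab
  have himg : U '' range F = univ := by
    rw [← range_comp]
    exact range_eq_univ.2 fun x => ⟨x, h.left_inv x⟩
  have hcont : ContinuousAt U (F u) :=
    hmono.continuousAt_of_image_mem_nhds hmem (by rw [himg]; exact Filter.univ_mem)
  refine HasDerivAt.of_local_left_inverse (f := F) hcont ?_ (h.pos u).ne' ?_
  · rw [h.left_inv]; exact h.hasDerivAt_primitive u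
  · filter_upwards [hmem]
    rintro _ ⟨a, rfl⟩
    rw [h.left_inv]

theorem continuousOn_inverse : ContinuousOn U (range F) := by
  rintro _ ⟨u, rfl⟩
  exact (h.hasDerivAt_inverse u).continuousAt.continuousWithinAt

/-! ### The tangent intercept and bounds on w² + u f(u) -/

theorem intercept_pos {u : ℝ} (hu : u ≤ 0) : 0 < intercept f u := by
  have := h.pos u
  have := mul_nonneg (neg_nonneg.2 hu) (h.deriv_nonneg u)
  unfold intercept
  linarith

theorem antitoneOn_intercept : AntitoneOn (intercept f) (Ici 0) := by
  have hd : ∀ x, HasDerivAt (intercept f) (-(x * deriv (deriv f) x)) x := fun x => by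
    exact ((h.differentiable x).hasDerivAt.fun_sub
      ((hasDerivAt_id' x).fun_mul (h.differentiable_deriv x).hasDerivAt)).congr_deriv (by ring)
  refine antitoneOn_of_deriv_nonpos (convex_Ici 0) h.continuous_intercept.continuousOn
    (fun x _ => (hd x).differentiableAt.differentiableWithinAt) fun x hx => ?_
  rw [interior_Ici] at hx
  rw [(hd x).deriv]
  have := mul_pos hx (h.deriv_deriv_pos x)
  linarith

/-- On the curve of energy C one has w² + u f(u) = 2C - (2F(u) - u f(u)), so the sign of the
intercept compares this quantity with 2(C - F(0)), its value at u = 0. -/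
theorem hasDerivAt_two_mul_primitive_sub (u : ℝ) :
    HasDerivAt (fun u => 2 * F u - u * f u) (intercept f u) u := by
  exact (((h.hasDerivAt_primitive u).const_mul 2).fun_sub
    ((hasDerivAt_id' u).fun_mul (h.differentiable u).hasDerivAt)).congr_deriv
    (by unfold intercept; ring)

theorem two_mul_primitive_sub_le {u : ℝ} (hu : u ≤ 0) : 2 * F u - u * f u ≤ 2 * F 0 := by
  have := monotoneOn_of_deriv_nonneg (convex_Iic (0 : ℝ))
    (fun x _ => (h.hasDerivAt_two_mul_primitive_sub x).continuousAt.continuousWithinAt)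
    (fun x _ => (h.hasDerivAt_two_mul_primitive_sub x).differentiableAt.differentiableWithinAt)
    (fun x hx => by
      rw [interior_Iic] at hx
      rw [(h.hasDerivAt_two_mul_primitive_sub x).deriv]
      exact (h.intercept_pos hx.le).le) hu self_mem_Iic hu
  simpa using this

theorem le_two_mul_primitive_sub {u : ℝ} (hu : 0 ≤ u) (hg : 0 ≤ intercept f u) :
    2 * F 0 ≤ 2 * F u - u * f u := by
  have := monotoneOn_of_deriv_nonneg (convex_Icc 0 u)
    (fun x _ => (h.hasDerivAt_two_mul_primitive_sub x).continuousAt.continuousWithinAt)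
    (fun x _ => (h.hasDerivAt_two_mul_primitive_sub x).differentiableAt.differentiableWithinAt)
    (fun x hx => by
      rw [interior_Icc] at hx
      rw [(h.hasDerivAt_two_mul_primitive_sub x).deriv]
      exact hg.trans (h.antitoneOn_intercept hx.1.le hu hx.2.le))
      (left_mem_Icc.2 hu) (right_mem_Icc.2 hu) hu
  simpa using this

theorem sq_add_mul_lower {C u w : ℝ} (hu : u ≤ 0) (hC : F u + w ^ 2 / 2 = C) :
    2 * (C - F 0) ≤ w ^ 2 + u * f u := by
  have := h.two_mul_primitive_sub_le hu
  linarith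

theorem sq_add_mul_upper {C u w : ℝ} (hu : 0 ≤ u) (hg : 0 ≤ intercept f u)
    (hC : F u + w ^ 2 / 2 = C) : w ^ 2 + u * f u ≤ 2 * (C - F 0) := by
  have := h.le_two_mul_primitive_sub hu hg
  linarith

/-- This is transversality: the curve of energy C crosses every ray at nonzero angular speed. It
makes the root on a ray differentiable in C. -/
theorem sq_add_mul_pos {C u w : ℝ} (hC₀ : F 0 < C) (hC : F u + w ^ 2 / 2 = C) :
    0 < w ^ 2 + u * f u := by
  rcases le_or_gt u 0 with hu | hu
  · have := h.sq_add_mul_lower hu hC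
    linarith
  · have := mul_pos hu (h.pos u)
    positivity

/-! ### Energy along a ray and its positive root -/

theorem hasDerivAt_rayEnergy (τ q : ℝ) :
    HasDerivAt (rayEnergy F τ) (τ * f (τ * q) + q) q := by
  have h1 : HasDerivAt (fun q => F (τ * q)) (f (τ * q) * (τ * 1)) q :=
    (h.hasDerivAt_primitive (τ * q)).comp q ((hasDerivAt_id q).const_mul τ)
  have h2 : HasDerivAt (fun q : ℝ => q ^ 2 / 2) q q := by
    exact ((hasDerivAt_pow 2 q).div_const 2).congr_deriv (by simp)
  exact (h1.fun_add h2).congr_deriv (by ring)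

theorem continuous_rayEnergy (τ : ℝ) : Continuous (rayEnergy F τ) :=
  continuous_iff_continuousAt.2 fun q => (h.hasDerivAt_rayEnergy τ q).continuousAt

theorem strictMono_deriv_rayEnergy (τ : ℝ) : StrictMono fun q => τ * f (τ * q) + q := by
  intro a b hab
  have : τ * f (τ * a) ≤ τ * f (τ * b) := by
    rcases le_total 0 τ with ht | ht
    · exact mul_le_mul_of_nonneg_left (h.monotone (mul_le_mul_of_nonneg_left hab.le ht)) ht
    · exact mul_le_mul_of_nonpos_left (h.monotone (mul_le_mul_of_nonpos_left hab.le ht)) ht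
  simp only
  linarith

theorem strictConvexOn_rayEnergy (τ : ℝ) : StrictConvexOn ℝ univ (rayEnergy F τ) := by
  apply StrictMono.strictConvexOn_univ_of_deriv (h.continuous_rayEnergy τ)
  have : deriv (rayEnergy F τ) = fun q => τ * f (τ * q) + q :=
    funext fun q => (h.hasDerivAt_rayEnergy τ q).deriv
  rw [this]
  exact h.strictMono_deriv_rayEnergy τ

/-- The energy along a ray is strictly convex and equals F 0 at q = 0; once back at F 0 or above, it
can only increase. Hence positive roots are unique. -/
theorem rayEnergy_lt {τ a b : ℝ} (ha : 0 < a) (hab : a < b) (hE : F 0 ≤ rayEnergy F τ a) :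
    rayEnergy F τ a < rayEnergy F τ b := by
  have h0 : rayEnergy F τ 0 = F 0 := by simp [rayEnergy]
  have hs := (h.strictConvexOn_rayEnergy τ).slope_strict_mono_adjacent (mem_univ 0) (mem_univ b)
    ha hab
  rw [h0] at hs
  have h1 : 0 ≤ (rayEnergy F τ a - F 0) / (a - 0) := by
    apply div_nonneg <;> linarith
  have h2 := (div_pos_iff_of_pos_right (sub_pos.2 hab)).1 (h1.trans_lt hs)
  linarith

theorem rayEnergy_injOn {τ a b : ℝ} (ha : 0 < a) (hb : 0 < b) (hE : F 0 ≤ rayEnergy F τ a)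
    (hab : rayEnergy F τ a = rayEnergy F τ b) : a = b := by
  rcases lt_trichotomy a b with hlt | heq | hgt
  · exact absurd hab (h.rayEnergy_lt ha hlt hE).ne
  · exact heq
  · exact absurd hab.symm (h.rayEnergy_lt hb hgt (hab ▸ hE)).ne

theorem lt_of_rayEnergy_lt {τ a b : ℝ} (hb : 0 < b) (hE : F 0 ≤ rayEnergy F τ b)
    (hab : rayEnergy F τ a < rayEnergy F τ b) : a < b := by
  by_contra! hba
  rcases hba.eq_or_lt with rfl | hlt
  · exact lt_irrefl _ hab
  · exact lt_asymm hab (h.rayEnergy_lt hb hlt hE)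

theorem exists_rayEnergy_eq (τ : ℝ) {C : ℝ} (hC : F 0 < C) :
    ∃ q, 0 < q ∧ rayEnergy F τ q = C := by
  have h0 : rayEnergy F τ 0 = F 0 := by simp [rayEnergy]
  -- Since F(τQ) ≥ F(0) - |f(0)τ| Q, this Q makes Q²/2 absorb the linear term and leaves at least
  -- Q(C - F(0)).
  set Q := 2 * |f 0 * τ| + 2 * (C - F 0) + 1 with hQ
  have hQ1 : 1 ≤ Q := by
    have := abs_nonneg (f 0 * τ)
    linarith
  have hQC : C ≤ rayEnergy F τ Q := by
    have h1 := h.primitive_lower_bound (τ * Q)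
    have h2 := neg_abs_le (f 0 * τ)
    have h3 := mul_le_mul_of_nonneg_right h2 (by linarith : (0 : ℝ) ≤ Q)
    have h4 : rayEnergy F τ Q = F (τ * Q) + Q ^ 2 / 2 := rfl
    have h5 : Q * Q = Q * (2 * |f 0 * τ| + 2 * (C - F 0) + 1) := congrArg (Q * ·) hQ
    have h6 := mul_nonneg (sub_nonneg.2 hQ1) (sub_pos.2 hC).le
    linarith
  obtain ⟨q, hq, hqC⟩ := intermediate_value_Icc (by linarith : (0 : ℝ) ≤ Q)
    (h.continuous_rayEnergy τ).continuousOn ⟨h0.symm ▸ hC.le, hQC⟩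
  refine ⟨q, hq.1.lt_of_ne' ?_, hqC⟩
  rintro rfl
  exact hC.ne (h0.symm.trans hqC)

theorem rayRoot_spec (τ : ℝ) {C : ℝ} (hC : F 0 < C) :
    0 < rayRoot F τ C ∧ rayEnergy F τ (rayRoot F τ C) = C := by
  unfold rayRoot
  rw [dif_pos (h.exists_rayEnergy_eq τ hC)]
  exact (h.exists_rayEnergy_eq τ hC).choose_spec

theorem rayRoot_eq {τ C q : ℝ} (hC : F 0 < C) (hq : 0 < q) (hE : rayEnergy F τ q = C) :
    rayRoot F τ C = q :=
  h.rayEnergy_injOn (h.rayRoot_spec τ hC).1 hq (by rw [(h.rayRoot_spec τ hC).2]; exact hC.le)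
    ((h.rayRoot_spec τ hC).2.trans hE.symm)

theorem strictMonoOn_rayRoot (τ : ℝ) : StrictMonoOn (rayRoot F τ) (Ioi (F 0)) := by
  intro C hC C' hC' hlt
  refine h.lt_of_rayEnergy_lt (τ := τ) (h.rayRoot_spec τ hC').1 ?_ ?_
  · rw [(h.rayRoot_spec τ hC').2]; exact le_of_lt hC'
  · rw [(h.rayRoot_spec τ hC').2, (h.rayRoot_spec τ hC).2]; exact hlt

theorem continuousAt_rayRoot (τ : ℝ) {C : ℝ} (hC : F 0 < C) : ContinuousAt (rayRoot F τ) C := by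
  refine (h.strictMonoOn_rayRoot τ).continuousAt_of_image_mem_nhds (Ioi_mem_nhds hC) ?_
  have hopen : IsOpen {q | 0 < q ∧ F 0 < rayEnergy F τ q} :=
    isOpen_Ioi.inter (isOpen_lt continuous_const (h.continuous_rayEnergy τ))
  obtain ⟨h1, h2⟩ := h.rayRoot_spec τ hC
  refine Filter.mem_of_superset (hopen.mem_nhds ⟨h1, h2.symm ▸ hC⟩) ?_
  rintro q ⟨hq, hqE⟩
  exact ⟨rayEnergy F τ q, hqE, h.rayRoot_eq hqE hq rfl⟩

theorem hasDerivAt_rayRoot (τ : ℝ) {C : ℝ} (hC : F 0 < C) :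
    HasDerivAt (rayRoot F τ) (rayRoot F τ C /
      (rayRoot F τ C ^ 2 + τ * rayRoot F τ C * f (τ * rayRoot F τ C))) C := by
  obtain ⟨h1, h2⟩ := h.rayRoot_spec τ hC
  have hS := h.sq_add_mul_pos hC h2
  have hd := h.hasDerivAt_rayEnergy τ (rayRoot F τ C)
  have hne : τ * f (τ * rayRoot F τ C) + rayRoot F τ C ≠ 0 := by
    intro h0
    apply hS.ne'
    linear_combination rayRoot F τ C * h0
  refine (HasDerivAt.of_local_left_inverse (h.continuousAt_rayRoot τ hC) hd hne ?_).congr_deriv ?_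
  · filter_upwards [Ioi_mem_nhds hC] with x hx using (h.rayRoot_spec τ hx).2
  · rw [inv_eq_one_div, div_eq_div_iff hne hS.ne']
    ring

end PhasePlane

/-! ### Derivative of the ray time with respect to the energy -/

theorem rayTime_eq_integral_unit (f F U : ℝ → ℝ) (τ C : ℝ) :
    rayTime f F U τ C =
      ∫ s in (0 : ℝ)..1, rayRoot F τ C * (1 / f (U (C - (rayRoot F τ C * s) ^ 2 / 2))) := by
  rw [intervalIntegral.integral_const_mul]
  have := intervalIntegral.smul_integral_comp_mul_left (a := 0) (b := 1)
    (fun w => 1 / f (U (C - w ^ 2 / 2))) (rayRoot F τ C)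
  rw [smul_eq_mul, mul_zero, mul_one] at this
  exact this.symm

/-- The derivative of the root of `rayEnergy F τ q = C` with respect to `C`. -/
def rayRootDeriv (f F : ℝ → ℝ) (τ C : ℝ) : ℝ :=
  rayRoot F τ C / (rayRoot F τ C ^ 2 + τ * rayRoot F τ C * f (τ * rayRoot F τ C))

/-- The derivative with respect to the energy of the integrand of `rayTime_eq_integral_unit`. -/
def unitIntegrandDeriv (f F U : ℝ → ℝ) (τ C s : ℝ) : ℝ :=
  rayRootDeriv f F τ C * (1 / f (U (C - (rayRoot F τ C * s) ^ 2 / 2))) +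
    rayRoot F τ C * (-(deriv f (U (C - (rayRoot F τ C * s) ^ 2 / 2)) /
      f (U (C - (rayRoot F τ C * s) ^ 2 / 2)) ^ 3) *
        (1 - rayRoot F τ C * rayRootDeriv f F τ C * s ^ 2))

namespace PhasePlane

variable {f F U : ℝ → ℝ} (h : PhasePlane f F U)

include h

theorem primitive_inverse {τ C w : ℝ} (hC : F 0 < C) (hw₀ : 0 ≤ w) (hw : w ≤ rayRoot F τ C) :
    F (U (C - w ^ 2 / 2)) = C - w ^ 2 / 2 := by
  apply h.right_inv (u₀ := τ * rayRoot F τ C)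
  have h1 : F (τ * rayRoot F τ C) + rayRoot F τ C ^ 2 / 2 = C := (h.rayRoot_spec τ hC).2
  have h2 := pow_le_pow_left₀ hw₀ hw 2
  linarith

theorem inverse_rayRoot {τ C : ℝ} (hC : F 0 < C) :
    U (C - rayRoot F τ C ^ 2 / 2) = τ * rayRoot F τ C := by
  have h1 : F (τ * rayRoot F τ C) + rayRoot F τ C ^ 2 / 2 = C := (h.rayRoot_spec τ hC).2
  rw [← eq_sub_of_add_eq h1, h.left_inv]

theorem hasDerivAt_one_div {s : ℝ} (hs : F (U s) = s) :
    HasDerivAt (fun s => 1 / f (U s)) (-(deriv f (U s) / f (U s) ^ 3)) s := by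
  have hU := h.hasDerivAt_inverse (U s)
  rw [hs] at hU
  have hp := h.pos (U s)
  have h1 : HasDerivAt (fun s => f (U s)) (deriv f (U s) * (f (U s))⁻¹) s :=
    (h.differentiable (U s)).hasDerivAt.comp s hU
  simp only [one_div]
  refine (h1.fun_inv hp.ne').congr_deriv ?_
  field_simp

theorem continuousOn_inverse_curve {τ C : ℝ} (hC : F 0 < C) :
    ContinuousOn (fun w => U (C - w ^ 2 / 2)) (Icc 0 (rayRoot F τ C)) := by
  refine h.continuousOn_inverse.comp (by fun_prop) ?_
  intro w hw
  exact ⟨_, h.primitive_inverse hC hw.1 hw.2⟩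

theorem curve_sq_add_mul_pos {τ C w : ℝ} (hC : F 0 < C) (hw₀ : 0 ≤ w) (hw : w ≤ rayRoot F τ C) :
    0 < w ^ 2 + U (C - w ^ 2 / 2) * f (U (C - w ^ 2 / 2)) :=
  h.sq_add_mul_pos hC (by rw [h.primitive_inverse hC hw₀ hw]; ring)

theorem continuousOn_rateDensity {τ C : ℝ} (hC : F 0 < C) :
    ContinuousOn (rateDensity f U C) (Icc 0 (rayRoot F τ C)) := by
  have hu := h.continuousOn_inverse_curve (τ := τ) hC
  have hf := h.continuous.comp_continuousOn hu
  refine ((h.continuous_intercept.comp_continuousOn hu).mul hu).div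
    (hf.mul ((((continuous_pow 2).continuousOn).add (hu.mul hf)).pow 2)) ?_
  intro w hw
  exact (mul_pos (h.pos _) (pow_pos (h.curve_sq_add_mul_pos hC hw.1 hw.2) 2)).ne'

theorem continuousOn_rayRoot (τ : ℝ) : ContinuousOn (rayRoot F τ) (Ioi (F 0)) :=
  fun _ hC => (h.continuousAt_rayRoot τ hC).continuousWithinAt

theorem continuousOn_rayRootDeriv (τ : ℝ) :
    ContinuousOn (rayRootDeriv f F τ) (Ioi (F 0)) := by
  have hq := h.continuousOn_rayRoot τ
  refine hq.div ((hq.pow 2).add ((continuousOn_const.mul hq).mul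
    (h.continuous.comp_continuousOn (continuousOn_const.mul hq)))) ?_
  intro C hC
  exact (h.sq_add_mul_pos hC (h.rayRoot_spec τ hC).2).ne'

theorem primitive_inverse_unit {τ C s : ℝ} (hC : F 0 < C) (hs : s ∈ Icc (0 : ℝ) 1) :
    F (U (C - (rayRoot F τ C * s) ^ 2 / 2)) = C - (rayRoot F τ C * s) ^ 2 / 2 :=
  h.primitive_inverse hC (mul_nonneg (h.rayRoot_spec τ hC).1.le hs.1)
    (mul_le_of_le_one_right (h.rayRoot_spec τ hC).1.le hs.2)

theorem continuousOn_inverse_unit (τ : ℝ) :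
    ContinuousOn (fun p : ℝ × ℝ => U (p.1 - (rayRoot F τ p.1 * p.2) ^ 2 / 2))
      (Ioi (F 0) ×ˢ Icc 0 1) := by
  have hq : ContinuousOn (fun p : ℝ × ℝ => rayRoot F τ p.1) (Ioi (F 0) ×ˢ Icc 0 1) :=
    (h.continuousOn_rayRoot τ).comp continuousOn_fst fun p hp => hp.1
  refine h.continuousOn_inverse.comp
    (continuousOn_fst.sub (((hq.mul continuousOn_snd).pow 2).div_const 2)) ?_
  rintro ⟨C, s⟩ ⟨hC, hs⟩
  exact ⟨_, h.primitive_inverse_unit hC hs⟩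

theorem continuousOn_unitIntegrandDeriv (τ : ℝ) :
    ContinuousOn (fun p : ℝ × ℝ => unitIntegrandDeriv f F U τ p.1 p.2)
      (Ioi (F 0) ×ˢ Icc 0 1) := by
  have hq : ContinuousOn (fun p : ℝ × ℝ => rayRoot F τ p.1) (Ioi (F 0) ×ˢ Icc 0 1) :=
    (h.continuousOn_rayRoot τ).comp continuousOn_fst fun p hp => hp.1
  have hq' : ContinuousOn (fun p : ℝ × ℝ => rayRootDeriv f F τ p.1) (Ioi (F 0) ×ˢ Icc 0 1) :=
    (h.continuousOn_rayRootDeriv τ).comp continuousOn_fst fun p hp => hp.1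
  have hu := h.continuousOn_inverse_unit τ
  have hf := h.continuous.comp_continuousOn hu
  have hf' := h.continuous_deriv.comp_continuousOn hu
  refine (hq'.mul (continuousOn_const.div hf fun p _ => (h.pos _).ne')).add
    (hq.mul ((hf'.div (hf.pow 3) fun p _ => (pow_pos (h.pos _) 3).ne').neg.mul
      (continuousOn_const.sub ((hq.mul hq').mul (continuousOn_snd.pow 2)))))

theorem hasDerivAt_unit_integrand {τ C s : ℝ} (hC : F 0 < C) (hs : s ∈ Icc (0 : ℝ) 1) :
    HasDerivAt (fun C => rayRoot F τ C * (1 / f (U (C - (rayRoot F τ C * s) ^ 2 / 2))))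
      (unitIntegrandDeriv f F U τ C s) C := by
  have hq : HasDerivAt (rayRoot F τ) (rayRootDeriv f F τ C) C := h.hasDerivAt_rayRoot τ hC
  have hin : HasDerivAt (fun C => C - (rayRoot F τ C * s) ^ 2 / 2)
      (1 - rayRoot F τ C * rayRootDeriv f F τ C * s ^ 2) C :=
    ((hasDerivAt_id' C).fun_sub (((hq.mul_const s).fun_pow 2).div_const 2)).congr_deriv
      (by push_cast; ring)
  have hcomp := (h.hasDerivAt_one_div (h.primitive_inverse_unit (τ := τ) hC hs)).comp C hin
  exact (hq.fun_mul hcomp)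

/-- After scaling w = q s the interval is fixed, and the derivative of the integrand is bounded by
compactness, so one may differentiate under the integral. -/
theorem hasDerivAt_rayTime_unit (τ : ℝ) {C : ℝ} (hC : F 0 < C) :
    HasDerivAt (rayTime f F U τ) (∫ s in (0 : ℝ)..1, unitIntegrandDeriv f F U τ C s) C := by
  obtain ⟨ε, hε, hball⟩ : ∃ ε > 0, Icc (C - ε) (C + ε) ⊆ Ioi (F 0) := by
    refine ⟨(C - F 0) / 2, by linarith, fun x hx => ?_⟩
    have := hx.1
    rw [mem_Ioi]
    linarith
  have hsub : Icc (C - ε) (C + ε) ×ˢ Icc (0 : ℝ) 1 ⊆ Ioi (F 0) ×ˢ Icc 0 1 :=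
    prod_mono hball Subset.rfl
  obtain ⟨B, hB⟩ := (isCompact_Icc.prod isCompact_Icc).exists_bound_of_continuousOn
    ((h.continuousOn_unitIntegrandDeriv τ).mono hsub)
  have hIoc : ∀ {t : ℝ}, t ∈ uIoc (0 : ℝ) 1 → t ∈ Icc (0 : ℝ) 1 := fun ht => by
    rw [uIoc_of_le zero_le_one] at ht
    exact Ioc_subset_Icc_self ht
  have hcont : ∀ x, F 0 < x → ContinuousOn
      (fun s => rayRoot F τ x * (1 / f (U (x - (rayRoot F τ x * s) ^ 2 / 2)))) (Icc 0 1) := by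
    intro x hx
    have hu : ContinuousOn (fun s => U (x - (rayRoot F τ x * s) ^ 2 / 2)) (Icc 0 1) :=
      (h.continuousOn_inverse_unit τ).comp (f := fun s : ℝ => (x, s)) (by fun_prop)
        fun s hs => ⟨hx, hs⟩
    exact continuousOn_const.mul (continuousOn_const.div (h.continuous.comp_continuousOn hu)
      fun s _ => (h.pos _).ne')
  have hcont' : ContinuousOn (unitIntegrandDeriv f F U τ C) (Icc 0 1) :=
    (h.continuousOn_unitIntegrandDeriv τ).comp (f := fun s : ℝ => (C, s)) (by fun_prop)
      fun s hs => ⟨hC, hs⟩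
  have key := intervalIntegral.hasDerivAt_integral_of_dominated_loc_of_deriv_le (𝕜 := ℝ)
    (μ := volume) (a := 0) (b := 1) (bound := fun _ => B) (x₀ := C)
    (F := fun x s => rayRoot F τ x * (1 / f (U (x - (rayRoot F τ x * s) ^ 2 / 2))))
    (F' := unitIntegrandDeriv f F U τ) (s := Icc (C - ε) (C + ε))
    (Icc_mem_nhds (by linarith) (by linarith)) ?_ ?_ ?_ ?_ ?_ ?_
  · rw [show rayTime f F U τ = _ from funext (rayTime_eq_integral_unit f F U τ)]
    exact key.2
  · filter_upwards [Ioi_mem_nhds hC] with x hx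
    exact ((hcont x hx).mono fun t ht => hIoc ht).aestronglyMeasurable measurableSet_uIoc
  · exact ((hcont C hC).mono (by rw [uIcc_of_le zero_le_one])).intervalIntegrable
  · exact (hcont'.mono fun t ht => hIoc ht).aestronglyMeasurable measurableSet_uIoc
  · exact Filter.Eventually.of_forall fun t ht x hx => hB (x, t) ⟨hx, hIoc ht⟩
  · exact intervalIntegrable_const
  · exact Filter.Eventually.of_forall fun t ht x hx =>
      h.hasDerivAt_unit_integrand (hball hx) (hIoc ht)

/-- The density comes from using the slope θ = u/w as coordinate: the time element is (w²/S) dθ with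
S = w² + u f(u), and at fixed θ one has ∂w/∂C = w/S, ∂u/∂C = u/S. Differentiating w²/S and returning
to w gives `rateDensity`. Scaling by s instead of moving along rays changes the integrand only by an
exact derivative, the one stated here. -/
theorem hasDerivAt_unit_primitive {τ C s : ℝ} (hC : F 0 < C) (hs : s ∈ Icc (0 : ℝ) 1) :
    HasDerivAt (fun s => rayRootDeriv f F τ C * s *
        (1 / f (U (C - (rayRoot F τ C * s) ^ 2 / 2))) -
      rayRoot F τ C * s * (1 / f (U (C - (rayRoot F τ C * s) ^ 2 / 2))) /
        ((rayRoot F τ C * s) ^ 2 + U (C - (rayRoot F τ C * s) ^ 2 / 2) *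
          f (U (C - (rayRoot F τ C * s) ^ 2 / 2))))
      (unitIntegrandDeriv f F U τ C s -
        rayRoot F τ C * rateDensity f U C (rayRoot F τ C * s)) s := by
  set q := rayRoot F τ C with hq
  set q' := rayRootDeriv f F τ C with hq'
  have hFU := h.primitive_inverse_unit (τ := τ) hC hs
  rw [← hq] at hFU
  have hin : HasDerivAt (fun s => C - (q * s) ^ 2 / 2) (-(q ^ 2 * s)) s :=
    ((((hasDerivAt_id' s).const_mul q).fun_pow 2).div_const 2).const_sub C |>.congr_deriv
      (by push_cast; ring)
  have hψ := (h.hasDerivAt_one_div hFU).comp s hin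
  have hU0 := h.hasDerivAt_inverse (U (C - (q * s) ^ 2 / 2))
  rw [hFU] at hU0
  have hU := hU0.comp s hin
  have hf := (h.differentiable (U (C - (q * s) ^ 2 / 2))).hasDerivAt.comp s hU
  have hS := h.curve_sq_add_mul_pos (τ := τ) hC
    (mul_nonneg (h.rayRoot_spec τ hC).1.le hs.1)
    (mul_le_of_le_one_right (h.rayRoot_spec τ hC).1.le hs.2)
  rw [← hq] at hS
  have hSd := (((hasDerivAt_id' s).const_mul q).fun_pow 2).fun_add (hU.fun_mul hf)
  have htot := (((hasDerivAt_id' s).const_mul q').fun_mul hψ).fun_sub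
    ((((hasDerivAt_id' s).const_mul q).fun_mul hψ).fun_div hSd hS.ne')
  refine htot.congr_deriv ?_
  simp only [unitIntegrandDeriv, rateDensity, intercept, ← hq, ← hq', Function.comp_def]
  have hp := h.pos (U (C - (q * s) ^ 2 / 2))
  generalize U (C - (q * s) ^ 2 / 2) = u at *
  generalize deriv f u = d at *
  generalize f u = y at *
  clear hSd htot hf hψ hU hU0 hFU
  generalize hT : (q * s) ^ 2 + u * y = T at *
  -- Eliminating u in favour of T leaves a rational identity in independent variables.
  have hu : u = (T - (q * s) ^ 2) / y := by
    rw [← hT]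
    field_simp
    ring
  rw [hu]
  push_cast
  field_simp
  ring

theorem hasDerivAt_rayTime (τ : ℝ) {C : ℝ} (hC : F 0 < C) :
    HasDerivAt (rayTime f F U τ) (∫ w in (0 : ℝ)..rayRoot F τ C, rateDensity f U C w) C := by
  refine (h.hasDerivAt_rayTime_unit τ hC).congr_deriv ?_
  have hq := (h.rayRoot_spec τ hC).1
  have hcont' : ContinuousOn (unitIntegrandDeriv f F U τ C) (Icc 0 1) :=
    (h.continuousOn_unitIntegrandDeriv τ).comp (f := fun s : ℝ => (C, s)) (by fun_prop)
      fun s hs => ⟨hC, hs⟩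
  have hK : ContinuousOn (fun s => rayRoot F τ C * rateDensity f U C (rayRoot F τ C * s))
      (Icc 0 1) := by
    refine continuousOn_const.mul ((h.continuousOn_rateDensity (τ := τ) hC).comp (by fun_prop) ?_)
    exact fun s hs => ⟨mul_nonneg hq.le hs.1, mul_le_of_le_one_right hq.le hs.2⟩
  have hu : uIcc (0 : ℝ) 1 = Icc 0 1 := uIcc_of_le zero_le_one
  have hint := intervalIntegral.integral_eq_sub_of_hasDerivAt
    (fun s hs => h.hasDerivAt_unit_primitive (τ := τ) hC (hu ▸ hs))
    ((hcont'.sub hK).mono hu.le).intervalIntegrable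
  rw [intervalIntegral.integral_sub (hcont'.mono hu.le).intervalIntegrable
    (hK.mono hu.le).intervalIntegrable] at hint
  have hscale := intervalIntegral.smul_integral_comp_mul_left (a := 0) (b := 1)
    (rateDensity f U C) (rayRoot F τ C)
  rw [smul_eq_mul, mul_zero, mul_one] at hscale
  rw [intervalIntegral.integral_const_mul, hscale] at hint
  -- The boundary terms vanish: at s = 0 trivially, at s = 1 because the derivative of the root q is
  -- q/S at the endpoint.
  simp only [mul_one, mul_zero, zero_mul, zero_div, sub_zero, h.inverse_rayRoot hC,
    rayRootDeriv] at hint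
  rw [← sub_eq_zero, hint]
  ring

/-! ### Comparison of two energy levels -/

/-- Along a level of `u`, the rate density at the larger energy is controlled by the one at the
smaller energy; the factor does not depend on the level. -/
theorem rateDensity_le {C₀ C₁ u x : ℝ} (hC₀ : F 0 < C₀) (hC : C₀ < C₁) (hx : 0 ≤ x)
    (hE : F u + x ^ 2 / 2 = C₀) (hu : 0 ≤ u → 0 ≤ intercept f u) :
    rateDensity f U C₁ √(x ^ 2 + 2 * (C₁ - C₀)) * (x / √(x ^ 2 + 2 * (C₁ - C₀))) ≤
      √((C₀ - F 0) / (C₁ - F 0)) * ((C₀ - F 0) / (C₁ - F 0)) ^ 2 * rateDensity f U C₀ x := by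
  have hδ : 0 < x ^ 2 + 2 * (C₁ - C₀) := by nlinarith [sq_nonneg x]
  set y := √(x ^ 2 + 2 * (C₁ - C₀)) with hy
  have hy0 : 0 < y := Real.sqrt_pos.2 hδ
  have hy2 : y ^ 2 = x ^ 2 + 2 * (C₁ - C₀) := Real.sq_sqrt hδ.le
  have hU₀ : U (C₀ - x ^ 2 / 2) = u := by rw [← eq_sub_of_add_eq hE, h.left_inv]
  have hU₁ : U (C₁ - y ^ 2 / 2) = u := by
    rw [hy2, show C₁ - (x ^ 2 + 2 * (C₁ - C₀)) / 2 = C₀ - x ^ 2 / 2 by ring, hU₀]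
  simp only [rateDensity, hU₀, hU₁]
  have hp := h.pos u
  have hS₀ := h.sq_add_mul_pos hC₀ hE
  have hS₁ : 0 < y ^ 2 + u * f u := by rw [hy2]; linarith
  have hc₁ : 0 < C₁ - F 0 := by linarith
  set S₀ := x ^ 2 + u * f u with hS₀d
  set S₁ := y ^ 2 + u * f u with hS₁d
  set r := (C₀ - F 0) / (C₁ - F 0) with hr
  have hr0 : 0 < r := div_pos (by linarith) hc₁
  have hSS : S₁ = S₀ + 2 * (C₁ - C₀) := by rw [hS₁d, hS₀d, hy2]; ring
  -- Only (1/S)² and the Jacobian x/y depend on the energy. Their quotients S₀/S₁ and x/y equal r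
  -- and √r at u = 0. They are at most these values for u ≥ 0 and at least these for u ≤ 0, where
  -- the common factor is nonpositive, so both cases give the same inequality.
  suffices hmain : intercept f u * u / f u * (1 / S₁ ^ 2 * (x / y)) ≤
      intercept f u * u / f u * ((r / S₀) ^ 2 * √r) by
    calc _ = intercept f u * u / f u * (1 / S₁ ^ 2 * (x / y)) := by field_simp
      _ ≤ _ := hmain
      _ = _ := by field_simp
  rcases le_total 0 u with h0 | h0
  · have hg := hu h0
    have hSu := h.sq_add_mul_upper h0 hg hE
    have hFu : F 0 ≤ F u := h.strictMono_primitive.monotone h0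
    refine mul_le_mul_of_nonneg_left ?_ (div_nonneg (mul_nonneg hg h0) hp.le)
    have h1 : 1 / S₁ ≤ r / S₀ := by
      rw [hr, div_div, div_le_div_iff₀ hS₁ (by positivity)]
      nlinarith
    have h2 : x / y ≤ √r := by
      apply Real.le_sqrt_of_sq_le
      rw [div_pow, hy2, hr, div_le_div_iff₀ hδ hc₁]
      nlinarith
    have h3 : 1 / S₁ ^ 2 ≤ (r / S₀) ^ 2 := by
      rw [← one_div_pow]
      exact pow_le_pow_left₀ (by positivity) h1 2
    exact mul_le_mul h3 h2 (by positivity) (by positivity)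
  · have hg := h.intercept_pos h0
    have hSl := h.sq_add_mul_lower h0 hE
    have hFu : F u ≤ F 0 := h.strictMono_primitive.monotone h0
    refine mul_le_mul_of_nonpos_left ?_
      (div_nonpos_of_nonpos_of_nonneg (mul_nonpos_of_nonneg_of_nonpos hg.le h0) hp.le)
    have h1 : r / S₀ ≤ 1 / S₁ := by
      rw [hr, div_div, div_le_div_iff₀ (by positivity) hS₁]
      nlinarith
    have h2 : √r ≤ x / y := by
      apply Real.sqrt_le_iff.2 ⟨by positivity, ?_⟩
      rw [div_pow, hy2, hr, div_le_div_iff₀ hc₁ hδ]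
      nlinarith
    have h3 : (r / S₀) ^ 2 ≤ 1 / S₁ ^ 2 := by
      rw [← one_div_pow]
      exact pow_le_pow_left₀ (by positivity) h1 2
    exact mul_le_mul h3 h2 (by positivity) (by positivity)

/-- The intercept is positive at 0 and nonincreasing on u ≥ 0, so it changes sign at most once; ρ =
β if it has not done so by β. -/
theorem exists_intercept_sign_change {β : ℝ} (hβ : 0 < β) :
    ∃ ρ, 0 < ρ ∧ ρ ≤ β ∧ 0 ≤ intercept f ρ ∧ ∀ u ∈ Ioc ρ β, intercept f u ≤ 0 := by
  rcases le_or_gt 0 (intercept f β) with hg | hg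
  · exact ⟨β, hβ, le_rfl, hg, fun u hu => absurd hu.1 (not_lt.2 hu.2)⟩
  · obtain ⟨ρ, hρ, hρ0⟩ := intermediate_value_Icc' hβ.le h.continuous_intercept.continuousOn
      ⟨hg.le, (h.intercept_pos le_rfl).le⟩
    have hρ1 : 0 < ρ := by
      refine hρ.1.lt_of_ne' ?_
      rintro rfl
      exact (h.intercept_pos le_rfl).ne' hρ0
    refine ⟨ρ, hρ1, hρ.2, hρ0.ge, fun u hu => ?_⟩
    rw [← hρ0]
    exact h.antitoneOn_intercept hρ1.le (hρ1.le.trans hu.1.le) hu.1.le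

theorem rateDensity_neg {C w : ℝ} (hC : F 0 < C) (hFU : F (U (C - w ^ 2 / 2)) = C - w ^ 2 / 2)
    (hu : U (C - w ^ 2 / 2) < 0) : rateDensity f U C w < 0 := by
  have hS := h.sq_add_mul_pos (w := w) hC (by rw [hFU]; ring)
  exact div_neg_of_neg_of_pos (mul_neg_of_pos_of_neg (h.intercept_pos hu.le) hu)
    (mul_pos (h.pos _) (pow_pos hS 2))

theorem rateDensity_nonpos {C w : ℝ} (hC : F 0 < C)
    (hFU : F (U (C - w ^ 2 / 2)) = C - w ^ 2 / 2) (hu : 0 ≤ U (C - w ^ 2 / 2))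
    (hg : intercept f (U (C - w ^ 2 / 2)) ≤ 0) : rateDensity f U C w ≤ 0 := by
  have hS := h.sq_add_mul_pos (w := w) hC (by rw [hFU]; ring)
  exact div_nonpos_of_nonpos_of_nonneg (mul_nonpos_of_nonpos_of_nonneg hg hu)
    (mul_pos (h.pos _) (pow_pos hS 2)).le

/-- If the time from the ray of slope `γ < 0` to the axis is nonincreasing in the energy, then the
time between the rays of slopes `γ` and `-γ` has negative derivative. -/
theorem integral_rateDensity_neg {γ C₁ : ℝ} (hγ : γ < 0)
    (hneg : ∀ C, F 0 < C → ∫ w in (0 : ℝ)..rayRoot F γ C, rateDensity f U C w ≤ 0)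
    (hC₁ : F 0 < C₁) :
    ∫ w in rayRoot F (-γ) C₁..rayRoot F γ C₁, rateDensity f U C₁ w < 0 := by
  obtain ⟨hb, hbE⟩ := h.rayRoot_spec (-γ) hC₁
  obtain ⟨ha, haE⟩ := h.rayRoot_spec γ hC₁
  have hKc := h.continuousOn_rateDensity (τ := γ) hC₁
  have hFU : ∀ w ∈ Icc 0 (rayRoot F γ C₁), F (U (C₁ - w ^ 2 / 2)) = C₁ - w ^ 2 / 2 :=
    fun w hw => h.primitive_inverse hC₁ hw.1 hw.2
  set b := rayRoot F (-γ) C₁ with hbd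
  set a := rayRoot F γ C₁ with had
  change F (-γ * b) + b ^ 2 / 2 = C₁ at hbE
  change F (γ * a) + a ^ 2 / 2 = C₁ at haE
  have hβ : 0 < -γ * b := mul_pos (neg_pos.2 hγ) hb
  obtain ⟨ρ, hρ, hρβ, hgρ, hgβ⟩ := h.exists_intercept_sign_change hβ
  -- The comparison energy is F ρ: its curve meets v = 0 exactly at u = ρ.
  have hC₀ : F 0 < F ρ := h.strictMono_primitive hρ
  have hFρβ : F ρ ≤ F (-γ * b) := h.strictMono_primitive.monotone hρβ
  have hb2 : 0 < b ^ 2 := by positivity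
  have hC : F ρ < C₁ := by linarith
  obtain ⟨ha₀, ha₀E⟩ := h.rayRoot_spec γ hC₀
  have hKc₀ := h.continuousOn_rateDensity (τ := γ) hC₀
  have haa : rayRoot F γ (F ρ) < a := h.strictMonoOn_rayRoot γ hC₀ hC₁ hC
  have hFU₀ : ∀ w ∈ Icc 0 (rayRoot F γ (F ρ)), F (U (F ρ - w ^ 2 / 2)) = F ρ - w ^ 2 / 2 :=
    fun w hw => h.primitive_inverse hC₀ hw.1 hw.2
  have hneg₀ := hneg _ hC₀
  set a₀ := rayRoot F γ (F ρ) with ha₀d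
  change F (γ * a₀) + a₀ ^ 2 / 2 = F ρ at ha₀E
  set δ := 2 * (C₁ - F ρ) with hδ
  have hδ0 : 0 < δ := by rw [hδ]; linarith
  have hγa : F (γ * a) < F (γ * a₀) :=
    h.strictMono_primitive (mul_lt_mul_of_neg_left haa hγ)
  set p := √(a₀ ^ 2 + δ) with hp
  have hp0 : 0 ≤ p := Real.sqrt_nonneg _
  have hp2 : p ^ 2 = a₀ ^ 2 + δ := Real.sq_sqrt (by positivity)
  have hd2 : √δ ^ 2 = δ := Real.sq_sqrt hδ0.le
  have hpa : p < a := by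
    refine lt_of_pow_lt_pow_left₀ 2 ha.le ?_
    rw [hp2, hδ]
    linarith
  have hbd' : b ≤ √δ := by
    refine Real.le_sqrt_of_sq_le ?_
    -- This reduces to F ρ ≤ F (-γ b), the choice of ρ below the height of the end point.
    rw [hδ]
    linarith
  have hdp : √δ ≤ p := Real.sqrt_le_sqrt (by linarith [sq_nonneg a₀])
  have hsub : ∀ {x y : ℝ}, 0 ≤ x → x ≤ y → y ≤ a → uIcc x y ⊆ Icc 0 a := by
    intro x y hx hxy hy
    rw [uIcc_of_le hxy]
    exact Icc_subset_Icc hx hy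
  have hI₁ : IntervalIntegrable (rateDensity f U C₁) volume b √δ :=
    (hKc.mono (hsub hb.le hbd' (hdp.trans hpa.le))).intervalIntegrable
  have hI₂ : IntervalIntegrable (rateDensity f U C₁) volume √δ p :=
    (hKc.mono (hsub (Real.sqrt_nonneg _) hdp hpa.le)).intervalIntegrable
  have hI₃ : IntervalIntegrable (rateDensity f U C₁) volume p a :=
    (hKc.mono (hsub hp0 hpa.le le_rfl)).intervalIntegrable
  rw [← intervalIntegral.integral_add_adjacent_intervals (hI₁.trans hI₂) hI₃,
    ← intervalIntegral.integral_add_adjacent_intervals hI₁ hI₂]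
  -- On this arc u lies between ρ and -γ b, where the intercept is nonpositive.
  have h₁ : ∫ w in b..√δ, rateDensity f U C₁ w ≤ 0 := by
    rw [← intervalIntegral.integral_zero (a := b) (b := √δ) (μ := volume) (E := ℝ)]
    refine intervalIntegral.integral_mono_on_of_le_Ioo hbd' hI₁ intervalIntegrable_const
      fun w hw => ?_
    have hw0 : 0 ≤ w := hb.le.trans hw.1.le
    have hF := hFU w ⟨hw0, hw.2.le.trans (hdp.trans hpa.le)⟩
    have hw1 := pow_le_pow_left₀ hb.le hw.1.le 2
    have hw2 := pow_lt_pow_left₀ hw.2 hw0 two_ne_zero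
    rw [hd2, hδ] at hw2
    have hl : ρ < U (C₁ - w ^ 2 / 2) :=
      h.strictMono_primitive.lt_iff_lt.1 (by rw [hF]; linarith)
    have hu : U (C₁ - w ^ 2 / 2) ≤ -γ * b :=
      h.strictMono_primitive.le_iff_le.1 (by rw [hF]; linarith)
    exact h.rateDensity_nonpos hC₁ hF (hρ.le.trans hl.le) (hgβ _ ⟨hl, hu⟩)
  -- Here u < γ a₀ < 0; this arc, nonempty since p < a, supplies the strict sign.
  have h₃ : ∫ w in p..a, rateDensity f U C₁ w < 0 := by
    rw [← neg_pos, ← intervalIntegral.integral_neg]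
    refine intervalIntegral.intervalIntegral_pos_of_pos_on hI₃.neg (fun w hw => neg_pos.2 ?_) hpa
    have hw0 : 0 ≤ w := hp0.trans hw.1.le
    have hF := hFU w ⟨hw0, hw.2.le⟩
    refine h.rateDensity_neg hC₁ hF (lt_of_lt_of_le ?_ (mul_neg_of_neg_of_pos hγ ha₀).le)
    have hw1 := pow_lt_pow_left₀ hw.1 hp0 two_ne_zero
    rw [hp2, hδ] at hw1
    exact h.strictMono_primitive.lt_iff_lt.1 (by rw [hF]; linarith)
  -- The substitution w = √(x² + δ) matches points of equal u on the two curves, and the arc of the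
  -- lower one is complete, from v = 0 to the ray γ.
  have h₂ : ∫ w in √δ..p, rateDensity f U C₁ w ≤ 0 := by
    have hder : ∀ x : ℝ, HasDerivAt (fun x => √(x ^ 2 + δ)) (x / √(x ^ 2 + δ)) x := fun x => by
      have h1 : HasDerivAt (fun x : ℝ => x ^ 2 + δ) (2 * x) x :=
        ((hasDerivAt_pow 2 x).add_const δ).congr_deriv (by simp)
      refine (h1.sqrt (by positivity)).congr_deriv ?_
      field_simp
    have hcs : Continuous fun x : ℝ => √(x ^ 2 + δ) := by fun_prop
    have himg : (fun x => √(x ^ 2 + δ)) '' uIcc 0 a₀ ⊆ Icc 0 a := by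
      rw [uIcc_of_le ha₀.le]
      rintro _ ⟨x, hx, rfl⟩
      refine ⟨Real.sqrt_nonneg _, (Real.sqrt_le_sqrt ?_).trans hpa.le⟩
      have := pow_le_pow_left₀ hx.1 hx.2 2
      linarith
    have hcd : Continuous fun x : ℝ => x / √(x ^ 2 + δ) :=
      continuous_id.div hcs fun x => (Real.sqrt_pos.2 (by positivity)).ne'
    have hsubst := intervalIntegral.integral_comp_mul_deriv' (a := 0) (b := a₀)
      (fun x _ => hder x) hcd.continuousOn (hKc.mono himg)
    simp only [Function.comp_def] at hsubst
    rw [show √((0 : ℝ) ^ 2 + δ) = √δ by simp] at hsubst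
    rw [← hsubst]
    have hKc₀' : ContinuousOn (rateDensity f U (F ρ)) (uIcc 0 a₀) := by
      rw [uIcc_of_le ha₀.le]; exact hKc₀
    calc _ ≤ ∫ x in (0 : ℝ)..a₀, √((F ρ - F 0) / (C₁ - F 0)) *
          ((F ρ - F 0) / (C₁ - F 0)) ^ 2 * rateDensity f U (F ρ) x := by
          refine intervalIntegral.integral_mono_on ha₀.le ?_ ?_ ?_
          · refine ContinuousOn.intervalIntegrable ?_
            exact (hKc.comp hcs.continuousOn fun x hx => himg ⟨x, hx, rfl⟩).mul hcd.continuousOn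
          · exact (continuousOn_const.mul hKc₀').intervalIntegrable
          · intro x hx
            have hF := hFU₀ x hx
            refine h.rateDensity_le hC₀ hC hx.1 (by rw [hF]; ring) fun hu => ?_
            refine hgρ.trans (h.antitoneOn_intercept hu hρ.le ?_)
            refine h.strictMono_primitive.le_iff_le.1 ?_
            rw [hF]
            linarith [sq_nonneg x]
      _ ≤ 0 := by
          rw [intervalIntegral.integral_const_mul]
          refine mul_nonpos_of_nonneg_of_nonpos ?_ hneg₀
          exact mul_nonneg (Real.sqrt_nonneg _) (sq_nonneg _)
  linarith

end PhasePlane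

/-! ### Trajectories and the time map -/

/-- A solution of `u' = κ v`, `v' = -κ f u` on `[0, L]` that starts on the ray `u = γ v` and ends
on the ray `u = -γ v`. -/
structure Trajectory (f : ℝ → ℝ) (κ γ L : ℝ) (u v : ℝ → ℝ) : Prop where
  continuousOn_fst : ContinuousOn u (Icc 0 L)
  continuousOn_snd : ContinuousOn v (Icc 0 L)
  hasDerivAt_fst : ∀ x ∈ Ioo 0 L, HasDerivAt u (κ * v x) x
  hasDerivAt_snd : ∀ x ∈ Ioo 0 L, HasDerivAt v (-(κ * f (u x))) x
  left : u 0 = γ * v 0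
  right : u L = -γ * v L

/-- Time reversal. -/
theorem Trajectory.reflect {f u v : ℝ → ℝ} {κ γ L : ℝ} (hT : Trajectory f κ γ L u v) :
    Trajectory f κ γ L (fun x => u (L - x)) (fun x => -v (L - x)) := by
  have hmaps : MapsTo (fun x => L - x) (Icc 0 L) (Icc 0 L) := fun x hx =>
    ⟨sub_nonneg.2 hx.2, sub_le_self L hx.1⟩
  have hmaps' : ∀ x ∈ Ioo 0 L, L - x ∈ Ioo 0 L := fun x hx =>
    ⟨sub_pos.2 hx.2, sub_lt_self L hx.1⟩
  have hd : ∀ x : ℝ, HasDerivAt (fun x => L - x) (-1) x := fun x => (hasDerivAt_id' x).const_sub L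
  refine ⟨hT.continuousOn_fst.comp (by fun_prop) hmaps,
    (hT.continuousOn_snd.comp (by fun_prop) hmaps).neg, fun x hx => ?_, fun x hx => ?_, ?_, ?_⟩
  · exact ((hT.hasDerivAt_fst _ (hmaps' x hx)).comp x (hd x)).congr_deriv (by ring)
  · exact ((hT.hasDerivAt_snd _ (hmaps' x hx)).comp x (hd x)).fun_neg.congr_deriv (by ring)
  · simp [hT.right]
  · simp [hT.left]

namespace PhasePlane

variable {f F U : ℝ → ℝ} (h : PhasePlane f F U)

include h

theorem strictAntiOn_rayTime_sub {γ : ℝ} (hγ : γ < 0)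
    (hanti : AntitoneOn (rayTime f F U γ) (Ioi (F 0))) :
    StrictAntiOn (fun C => rayTime f F U γ C - rayTime f F U (-γ) C) (Ioi (F 0)) := by
  have hneg : ∀ C, F 0 < C → ∫ w in (0 : ℝ)..rayRoot F γ C, rateDensity f U C w ≤ 0 := by
    intro C hC
    rw [← (h.hasDerivAt_rayTime γ hC).deriv,
      ← derivWithin_of_isOpen isOpen_Ioi (mem_Ioi.2 hC)]
    exact hanti.derivWithin_nonpos
  have hd : ∀ C, F 0 < C → HasDerivAt (fun C => rayTime f F U γ C - rayTime f F U (-γ) C) _ C :=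
    fun C hC => (h.hasDerivAt_rayTime γ hC).fun_sub (h.hasDerivAt_rayTime (-γ) hC)
  refine strictAntiOn_of_deriv_neg (convex_Ioi _)
    (fun C hC => (hd C hC).continuousAt.continuousWithinAt) fun C hC => ?_
  rw [interior_Ioi] at hC
  rw [(hd C hC).deriv]
  have hint : ∀ τ, IntervalIntegrable (rateDensity f U C) volume 0 (rayRoot F τ C) := fun τ => by
    refine ContinuousOn.intervalIntegrable ?_
    rw [uIcc_of_le (h.rayRoot_spec τ hC).1.le]
    exact h.continuousOn_rateDensity hC
  rw [intervalIntegral.integral_interval_sub_left (hint γ) (hint (-γ))]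
  exact h.integral_rateDensity_neg hγ hneg hC

theorem continuousOn_one_div {C a u₀ : ℝ} (hE : F u₀ + a ^ 2 / 2 = C) :
    ContinuousOn (fun w => 1 / f (U (C - w ^ 2 / 2))) (Icc 0 a) := by
  refine continuousOn_const.div (h.continuous.comp_continuousOn
    (h.continuousOn_inverse.comp (by fun_prop) fun w hw => ?_)) fun w _ => (h.pos _).ne'
  refine ⟨_, h.right_inv (u₀ := u₀) ?_⟩
  have := pow_le_pow_left₀ hw.1 hw.2 2
  linarith

section Trajectory

variable {κ γ L : ℝ} {u v : ℝ → ℝ} (hT : Trajectory f κ γ L u v)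

include hT

theorem energy_eq {x : ℝ} (hx : x ∈ Icc 0 L) : F (u x) + v x ^ 2 / 2 = F (u 0) + v 0 ^ 2 / 2 := by
  have hd : ∀ x ∈ Ioo 0 L, HasDerivAt (fun x => F (u x) + v x ^ 2 / 2) 0 x := fun x hx =>
    (((h.hasDerivAt_primitive (u x)).comp x (hT.hasDerivAt_fst x hx)).fun_add
      (((hT.hasDerivAt_snd x hx).fun_pow 2).div_const 2)).congr_deriv (by push_cast; ring)
  have hc : ContinuousOn (fun x => F (u x) + v x ^ 2 / 2) (Icc 0 L) :=
    (h.continuous_primitive.comp_continuousOn hT.continuousOn_fst).add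
      ((hT.continuousOn_snd.pow 2).div_const 2)
  have h0 : (0 : ℝ) ∈ Icc 0 L := ⟨le_rfl, hx.1.trans hx.2⟩
  have hint : ∀ x ∈ interior (Icc 0 L), x ∈ Ioo 0 L := fun x hx => by rwa [interior_Icc] at hx
  have hdiff : DifferentiableOn ℝ (fun x => F (u x) + v x ^ 2 / 2) (interior (Icc 0 L)) :=
    fun x hx => (hd x (hint x hx)).differentiableAt.differentiableWithinAt
  exact le_antisymm
    (antitoneOn_of_deriv_nonpos (convex_Icc 0 L) hc hdiff
      (fun x hx => (hd x (hint x hx)).deriv.le) h0 hx hx.1)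
    (monotoneOn_of_deriv_nonneg (convex_Icc 0 L) hc hdiff
      (fun x hx => (hd x (hint x hx)).deriv.ge) h0 hx hx.1)

theorem strictAntiOn_snd (hκ : 0 < κ) : StrictAntiOn v (Icc 0 L) := by
  refine strictAntiOn_of_deriv_neg (convex_Icc 0 L) hT.continuousOn_snd fun x hx => ?_
  rw [interior_Icc] at hx
  rw [(hT.hasDerivAt_snd x hx).deriv]
  exact neg_neg_of_pos (mul_pos hκ (h.pos _))

theorem fst_eq {x : ℝ} (hx : x ∈ Icc 0 L) :
    u x = U (F (u 0) + v 0 ^ 2 / 2 - v x ^ 2 / 2) := by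
  rw [← h.energy_eq hT hx, add_sub_cancel_right, h.left_inv]

/-- The time map. -/
theorem time_eq (hκ : 0 < κ) (hv : ∀ x ∈ Icc 0 L, 0 ≤ v x) {x : ℝ} (hx : x ∈ Icc 0 L) :
    ∫ w in v x..v 0, 1 / f (U (F (u 0) + v 0 ^ 2 / 2 - w ^ 2 / 2)) = κ * x := by
  have hx0 : uIcc 0 x = Icc 0 x := uIcc_of_le hx.1
  have hsub : Icc 0 x ⊆ Icc 0 L := Icc_subset_Icc_right hx.2
  have hanti := (h.strictAntiOn_snd hT hκ).antitoneOn
  have h0 : (0 : ℝ) ∈ Icc 0 L := ⟨le_rfl, hx.1.trans hx.2⟩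
  have hg := h.continuousOn_one_div (C := F (u 0) + v 0 ^ 2 / 2) rfl
  have himg : v '' Icc 0 x ⊆ Icc 0 (v 0) := by
    rintro _ ⟨y, hy, rfl⟩
    exact ⟨hv y (hsub hy), hanti h0 (hsub hy) hy.1⟩
  have heq : ∀ y ∈ Icc 0 L, 1 / f (U (F (u 0) + v 0 ^ 2 / 2 - v y ^ 2 / 2)) *
      (-(κ * f (u y))) = -κ := by
    intro y hy
    rw [← h.fst_eq hT hy]
    have := (h.pos (u y)).ne'
    field_simp
  have hsubst := intervalIntegral.integral_comp_mul_deriv''' (a := 0) (b := x) (f := v)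
    (f' := fun y => -(κ * f (u y)))
    (g := fun w => 1 / f (U (F (u 0) + v 0 ^ 2 / 2 - w ^ 2 / 2))) ?_ ?_ ?_ ?_ ?_
  · have hconst : ∫ y in (0 : ℝ)..x, ((fun w => 1 / f (U (F (u 0) + v 0 ^ 2 / 2 - w ^ 2 / 2))) ∘ v)
        y * (-(κ * f (u y))) = ∫ y in (0 : ℝ)..x, -κ := by
      refine intervalIntegral.integral_congr fun y hy => ?_
      rw [hx0] at hy
      exact heq y (hsub hy)
    rw [intervalIntegral.integral_symm, ← hsubst, hconst, intervalIntegral.integral_const]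
    simp [mul_comm]
  · rw [hx0]; exact hT.continuousOn_snd.mono hsub
  · intro y hy
    rw [min_eq_left hx.1, max_eq_right hx.1] at hy
    exact (hT.hasDerivAt_snd y ⟨hy.1, hy.2.trans_le hx.2⟩).hasDerivWithinAt
  · rw [min_eq_left hx.1, max_eq_right hx.1]
    exact hg.mono ((image_mono Ioo_subset_Icc_self).trans himg)
  · rw [hx0]
    exact (hg.integrableOn_Icc).mono_set himg
  · rw [hx0]
    refine (integrableOn_const (C := -κ) (by simp) (by simp)).congr_fun (fun y hy => ?_)
      measurableSet_Icc
    exact (heq y (hsub hy)).symm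

/-- The trajectory ends at u = -γ v ≥ 0, where F is at least F 0. -/
theorem energy_ge (hL : 0 < L) (hγ : γ < 0) (hvL : 0 ≤ v L) : F 0 ≤ F (u 0) + v 0 ^ 2 / 2 := by
  rw [← h.energy_eq hT (right_mem_Icc.2 hL.le), hT.right]
  have : F 0 ≤ F (-γ * v L) :=
    h.strictMono_primitive.monotone (mul_nonneg (neg_pos.2 hγ).le hvL)
  linarith [sq_nonneg (v L)]

end Trajectory

section Trajectory

variable {κ γ L : ℝ} {u v u' v' : ℝ → ℝ}

/-- Two trajectories in `v ≥ 0` with the same energy coincide. -/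
theorem eqOn_of_energy_eq (hκ : 0 < κ) (hγ : γ < 0) (hL : 0 < L)
    (hT : Trajectory f κ γ L u v) (hv : ∀ x ∈ Icc 0 L, 0 ≤ v x)
    (hT' : Trajectory f κ γ L u' v') (hv' : ∀ x ∈ Icc 0 L, 0 ≤ v' x)
    (hE : F (u 0) + v 0 ^ 2 / 2 = F (u' 0) + v' 0 ^ 2 / 2) : EqOn u u' (Icc 0 L) := by
  have h0 : (0 : ℝ) ∈ Icc 0 L := left_mem_Icc.2 hL.le
  have h1 : L ∈ Icc 0 L := right_mem_Icc.2 hL.le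
  have ha : 0 < v 0 := (hv L h1).trans_lt (h.strictAntiOn_snd hT hκ h0 h1 hL)
  have ha' : 0 < v' 0 := (hv' L h1).trans_lt (h.strictAntiOn_snd hT' hκ h0 h1 hL)
  have hge := h.energy_ge hT hL hγ (hv L h1)
  -- The starting point is the unique positive root on the ray γ.
  have hv0 : v 0 = v' 0 := by
    refine h.rayEnergy_injOn (τ := γ) ha ha' ?_ ?_
    · rwa [rayEnergy, ← hT.left]
    · rw [rayEnergy, rayEnergy, ← hT.left, ← hT'.left, hE]
  intro x hx
  have hg := h.continuousOn_one_div (C := F (u 0) + v 0 ^ 2 / 2) rfl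
  have hI : ∀ {y}, 0 ≤ y → y ≤ v 0 → IntervalIntegrable
      (fun w => 1 / f (U (F (u 0) + v 0 ^ 2 / 2 - w ^ 2 / 2))) volume y (v 0) := by
    intro y hy hy'
    refine (hg.mono ?_).intervalIntegrable
    rw [uIcc_of_le hy']
    exact Icc_subset_Icc_left hy
  have hle := (h.strictAntiOn_snd hT hκ).antitoneOn h0 hx hx.1
  have hle' := (h.strictAntiOn_snd hT' hκ).antitoneOn h0 hx hx.1
  rw [← hv0] at hle'
  have ht := h.time_eq hT hκ hv hx
  have ht' := h.time_eq hT' hκ hv' hx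
  rw [← hE, ← hv0, ← ht] at ht'
  -- Both trajectories have used the same time κ x, so the positive integrand has zero integral
  -- between v x and v' x.
  have hsub := intervalIntegral.integral_interval_sub_interval_comm (hI (hv' x hx) hle')
    (hI (hv x hx) hle) ((hI (hv' x hx) hle').trans (hI (hv x hx) hle).symm)
  rw [ht', sub_self, intervalIntegral.integral_same, sub_zero] at hsub
  have hvx : v x = v' x := by
    rcases lt_trichotomy (v x) (v' x) with hlt | heq | hgt
    · have := intervalIntegral.intervalIntegral_pos_of_pos
        ((hI (hv x hx) hle).trans (hI (hv' x hx) hle').symm)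
        (fun w => one_div_pos.2 (h.pos _)) hlt
      rw [intervalIntegral.integral_symm, ← hsub, neg_zero] at this
      exact absurd this (lt_irrefl 0)
    · exact heq
    · have := intervalIntegral.intervalIntegral_pos_of_pos
        ((hI (hv' x hx) hle').trans (hI (hv x hx) hle).symm)
        (fun w => one_div_pos.2 (h.pos _)) hgt
      rw [← hsub] at this
      exact absurd this (lt_irrefl 0)
  rw [h.fst_eq hT hx, h.fst_eq hT' hx, hE, hvx]

/-- The time map of a trajectory in `v ≥ 0` with energy above `F 0`. -/
theorem rayTime_sub_eq (hκ : 0 < κ) (hL : 0 < L)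
    (hT : Trajectory f κ γ L u v) (hv : ∀ x ∈ Icc 0 L, 0 ≤ v x)
    (hE : F 0 < F (u 0) + v 0 ^ 2 / 2) :
    rayTime f F U γ (F (u 0) + v 0 ^ 2 / 2) - rayTime f F U (-γ) (F (u 0) + v 0 ^ 2 / 2) =
      κ * L := by
  have h0 : (0 : ℝ) ∈ Icc 0 L := left_mem_Icc.2 hL.le
  have h1 : L ∈ Icc 0 L := right_mem_Icc.2 hL.le
  have hba := h.strictAntiOn_snd hT hκ h0 h1 hL
  -- If v L = 0, the end condition gives u L = 0 and the energy is F 0.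
  have hb : 0 < v L := by
    refine (hv L h1).lt_of_ne' fun hb => ?_
    have := h.energy_eq hT h1
    rw [hT.right, hb] at this
    simp only [mul_zero] at this
    linarith
  have hra : rayRoot F γ (F (u 0) + v 0 ^ 2 / 2) = v 0 :=
    h.rayRoot_eq hE (hb.trans hba) (by rw [rayEnergy, ← hT.left])
  have hrb : rayRoot F (-γ) (F (u 0) + v 0 ^ 2 / 2) = v L :=
    h.rayRoot_eq hE hb (by rw [rayEnergy, ← hT.right, h.energy_eq hT h1])
  have hg := h.continuousOn_one_div (C := F (u 0) + v 0 ^ 2 / 2) rfl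
  have hI : ∀ y, 0 ≤ y → y ≤ v 0 → IntervalIntegrable
      (fun w => 1 / f (U (F (u 0) + v 0 ^ 2 / 2 - w ^ 2 / 2))) volume 0 y := by
    intro y hy hy'
    refine (hg.mono ?_).intervalIntegrable
    rw [uIcc_of_le hy]
    exact Icc_subset_Icc_right hy'
  rw [rayTime, rayTime, hra, hrb, intervalIntegral.integral_interval_sub_left
    (hI _ (hb.trans hba).le le_rfl) (hI _ hb.le hba.le), h.time_eq hT hκ hv h1]

/-- Two trajectories in `v ≥ 0` with energies above `F 0` coincide. -/
theorem eqOn_of_energy_gt (hκ : 0 < κ) (hγ : γ < 0) (hL : 0 < L)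
    (hanti : AntitoneOn (rayTime f F U γ) (Ioi (F 0)))
    (hT : Trajectory f κ γ L u v) (hv : ∀ x ∈ Icc 0 L, 0 ≤ v x)
    (hT' : Trajectory f κ γ L u' v') (hv' : ∀ x ∈ Icc 0 L, 0 ≤ v' x)
    (hE : F 0 < F (u 0) + v 0 ^ 2 / 2) (hE' : F 0 < F (u' 0) + v' 0 ^ 2 / 2) :
    EqOn u u' (Icc 0 L) := by
  refine h.eqOn_of_energy_eq hκ hγ hL hT hv hT' hv' ?_
  refine (h.strictAntiOn_rayTime_sub hγ hanti).injOn hE hE' ?_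
  rw [h.rayTime_sub_eq hκ hL hT hv hE, h.rayTime_sub_eq hκ hL hT' hv' hE']

theorem encard_trajectories_le_two (hκ : 0 < κ) (hγ : γ < 0) (hL : 0 < L)
    (hanti : AntitoneOn (rayTime f F U γ) (Ioi (F 0))) :
    {w : Icc (0 : ℝ) L → ℝ | ∃ u v, Trajectory f κ γ L u v ∧ (∀ x ∈ Icc 0 L, 0 ≤ v x) ∧
      (Icc (0 : ℝ) L).domRestrict u = w}.encard ≤ 2 := by
  have hext : ∀ {u u' : ℝ → ℝ}, EqOn u u' (Icc 0 L) →
      (Icc (0 : ℝ) L).domRestrict u = (Icc (0 : ℝ) L).domRestrict u' :=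
    fun hu => funext fun x => hu x.2
  -- The level F 0 is treated separately: there the end point is the origin, and the monotonicity of
  -- the time map is available only above it.
  set A := {w : Icc (0 : ℝ) L → ℝ | ∃ u v, Trajectory f κ γ L u v ∧ (∀ x ∈ Icc 0 L, 0 ≤ v x) ∧
      F 0 = F (u 0) + v 0 ^ 2 / 2 ∧ (Icc (0 : ℝ) L).domRestrict u = w} with hA
  set B := {w : Icc (0 : ℝ) L → ℝ | ∃ u v, Trajectory f κ γ L u v ∧ (∀ x ∈ Icc 0 L, 0 ≤ v x) ∧
      F 0 < F (u 0) + v 0 ^ 2 / 2 ∧ (Icc (0 : ℝ) L).domRestrict u = w} with hB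
  have hA1 : A.encard ≤ 1 := by
    rw [encard_le_one_iff]
    rintro _ _ ⟨u, v, hT, hv, hE, rfl⟩ ⟨u', v', hT', hv', hE', rfl⟩
    exact hext (h.eqOn_of_energy_eq hκ hγ hL hT hv hT' hv' (hE.symm.trans hE'))
  have hB1 : B.encard ≤ 1 := by
    rw [encard_le_one_iff]
    rintro _ _ ⟨u, v, hT, hv, hE, rfl⟩ ⟨u', v', hT', hv', hE', rfl⟩
    exact hext (h.eqOn_of_energy_gt hκ hγ hL hanti hT hv hT' hv' hE hE')
  calc _ ≤ (A ∪ B).encard := by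
        refine encard_le_encard ?_
        rintro _ ⟨u, v, hT, hv, rfl⟩
        rcases (h.energy_ge hT hL hγ (hv L (right_mem_Icc.2 hL.le))).eq_or_lt with hE | hE
        · exact Or.inl ⟨u, v, hT, hv, hE, rfl⟩
        · exact Or.inr ⟨u, v, hT, hv, hE, rfl⟩
    _ ≤ A.encard + B.encard := encard_union_le A B
    _ ≤ 1 + 1 := add_le_add hA1 hB1
    _ = 2 := one_add_one_eq_two

end Trajectory

end PhasePlane

/-! ### From the Robin problem to the phase plane -/

theorem hasDerivAt_F {f : ℝ → ℝ} (hf : Continuous f) (u : ℝ) : HasDerivAt (F f) (f u) u := by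
  have hd : HasDerivAt (fun u => ∫ t in (0 : ℝ)..u, f t) (f u) u :=
    intervalIntegral.integral_hasDerivAt_right (hf.intervalIntegrable _ _)
      hf.stronglyMeasurable.stronglyMeasurableAtFilter hf.continuousAt
  by_cases hi : IntegrableOn f (Iic 0)
  · have hall : ∀ x, IntegrableOn f (Iic x) := fun x =>
      (hi.union (hf.integrableOn_Icc (a := 0) (b := x))).mono_set fun y hy =>
        (le_total y 0).imp id fun h0 => ⟨h0, hy⟩
    have heq : F f = fun u => (∫ t in Iic (0 : ℝ), f t) + ∫ t in (0 : ℝ)..u, f t := by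
      funext x
      rw [F, if_pos hi, ← intervalIntegral.integral_Iic_sub_Iic hi (hall x)]
      ring
    rw [heq]
    exact hd.const_add _
  · have heq : F f = fun u => ∫ t in (0 : ℝ)..u, f t := by
      funext x
      rw [F, if_neg hi]
    rwa [heq]

theorem phasePlane_F {f : ℝ → ℝ} (hf : Differentiable ℝ f) (hf' : Differentiable ℝ (deriv f))
    (hpos : ∀ u, 0 < f u) (hmono : ∀ u, 0 ≤ deriv f u) (hconv : ∀ u, 0 < deriv (deriv f) u) :
    PhasePlane f (F f) (Finv f) where
  differentiable := hf
  differentiable_deriv := hf'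
  pos := hpos
  deriv_nonneg := hmono
  deriv_deriv_pos := hconv
  hasDerivAt_primitive := hasDerivAt_F hf.continuous
  left_inv := by
    have hs : StrictMono (F f) := strictMono_of_deriv_pos fun u => by
      rw [(hasDerivAt_F hf.continuous u).deriv]
      exact hpos u
    exact Function.leftInverse_invFun hs.injective

theorem v₁_eq_rayRoot {f : ℝ → ℝ} (h : PhasePlane f (F f) (Finv f)) (α lam : ℝ) {C : ℝ}
    (hC : F f 0 < C) : v₁ f α lam C = rayRoot (F f) (√lam / α) C := by
  obtain ⟨hq, hE⟩ := h.rayRoot_spec (√lam / α) hC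
  refine IsGreatest.csSup_eq ⟨⟨(rayRoot (F f) (√lam / α) C,
    √lam / α * rayRoot (F f) (√lam / α) C), ⟨eq_sub_of_add_eq hE, rfl⟩, rfl⟩, ?_⟩
  rintro _ ⟨⟨w, y⟩, ⟨hK, hl⟩, rfl⟩
  have hy : y = √lam / α * w := hl
  have hw : F f y = C - w ^ 2 / 2 := hK
  have hwE : rayEnergy (F f) (√lam / α) w = C := by
    rw [rayEnergy, ← hy, hw]
    ring
  -- A nonpositive intersection is below the positive root, and a positive one equals it.
  rcases le_or_gt w 0 with hw0 | hw0
  · exact hw0.trans hq.le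
  · exact (h.rayRoot_eq hC hw0 hwE).ge

theorem L₁_eq_rayTime {f : ℝ → ℝ} (h : PhasePlane f (F f) (Finv f)) (α lam : ℝ) {C : ℝ}
    (hC : F f 0 < C) :
    L₁ f α lam C = 2 / √lam * rayTime f (F f) (Finv f) (√lam / α) C := by
  rw [L₁, v₁_eq_rayRoot h α lam hC, rayTime, ← intervalIntegral.integral_const_mul,
    ← intervalIntegral.integral_const_mul]
  congr 1
  funext w
  rw [div_mul_div_comm, mul_one_div, mul_one]

theorem IsSolution.trajectory {f u : ℝ → ℝ} {α lam L : ℝ} (hα : α < 0) (hlam : 0 < lam)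
    (hL : 0 < L) (hu : IsSolution f α lam L u) :
    Trajectory f √lam (√lam / α) L u (fun x => derivWithin u (Icc 0 L) x / √lam) := by
  have hs : 0 < √lam := Real.sqrt_pos.2 hlam
  have hα' := hα.ne
  have hmem : ∀ x ∈ Ioo 0 L, Icc 0 L ∈ nhds x := fun x hx => Icc_mem_nhds hx.1 hx.2
  refine ⟨hu.contDiffOn.continuousOn, (hu.contDiffOn.continuousOn_derivWithin
    (uniqueDiffOn_Icc hL) le_rfl).div_const _, fun x hx => ?_, fun x hx => ?_, ?_, ?_⟩
  · have hd := (hu.contDiffOn.differentiableOn one_ne_zero x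
      (Ioo_subset_Icc_self hx)).differentiableAt (hmem x hx)
    simp only [derivWithin_of_mem_nhds (hmem x hx)]
    exact hd.hasDerivAt.congr_deriv (by field_simp)
  · have heq : (fun x => derivWithin u (Icc 0 L) x / √lam) =ᶠ[nhds x]
        fun x => deriv u x / √lam := by
      filter_upwards [isOpen_Ioo.mem_nhds hx] with y hy
      rw [derivWithin_of_mem_nhds (hmem y hy)]
    refine (((hu.ode x hx).div_const √lam).congr_of_eventuallyEq heq).congr_deriv ?_
    rw [neg_div, mul_div_right_comm, Real.div_sqrt]
  · simp only [hu.left]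
    field_simp
  · simp only [hu.right]
    field_simp

end RobinBVP

end

theorem mainTheorem10 (f : ℝ → ℝ) (α lam L : ℝ)
    (hf : Differentiable ℝ f) (hf' : Differentiable ℝ (deriv f))
    (hpos : ∀ u, 0 < f u) (hmono : ∀ u, 0 ≤ deriv f u)
    (hsuper : Filter.Tendsto (fun u => f u / u) Filter.atTop Filter.atTop)
    (hconv : ∀ u, 0 < deriv (deriv f) u)
    (hα : α < 0) (hlam : 0 < lam) (hL : 0 < L)
    (hL₁ : StrictAntiOn (RobinBVP.L₁ f α lam) (Set.Ioi (RobinBVP.s₀ f))) :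
    (RobinBVP.solutionsOn f α lam L (fun u => MonotoneOn u (Set.Icc 0 L))).encard ≤ 2 ∧
    (RobinBVP.solutionsOn f α lam L (fun u => AntitoneOn u (Set.Icc 0 L))).encard ≤ 2 := by
  have h := RobinBVP.phasePlane_F hf hf' hpos hmono hconv
  have hs : 0 < √lam := Real.sqrt_pos.2 hlam
  have hγ : √lam / α < 0 := div_neg_of_pos_of_neg hs hα
  have hanti : AntitoneOn (RobinBVP.rayTime f (RobinBVP.F f) (RobinBVP.Finv f) (√lam / α))
      (Set.Ioi (RobinBVP.F f 0)) := by
    intro C hC C' hC' hle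
    have h1 := hL₁.antitoneOn hC hC' hle
    rw [RobinBVP.L₁_eq_rayTime h α lam hC, RobinBVP.L₁_eq_rayTime h α lam hC'] at h1
    exact le_of_mul_le_mul_left h1 (by positivity)
  have hcard := h.encard_trajectories_le_two hs hγ hL hanti
  refine ⟨(Set.encard_le_encard ?_).trans hcard, ?_⟩
  · rintro _ ⟨u, ⟨hu, hum⟩, rfl⟩
    exact ⟨u, _, hu.trajectory hα hlam hL,
      fun x _ => div_nonneg hum.derivWithin_nonneg hs.le, rfl⟩
  · let R : Set.Icc (0 : ℝ) L → Set.Icc (0 : ℝ) L := fun x =>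
      ⟨L - x, sub_nonneg.2 x.2.2, sub_le_self L x.2.1⟩
    have hR : Function.Injective fun w : Set.Icc (0 : ℝ) L → ℝ => w ∘ R := by
      refine Function.Surjective.injective_comp_right fun x => ⟨R x, ?_⟩
      exact Subtype.ext (sub_sub_cancel L (x : ℝ))
    -- Time reversal is injective, so it suffices to count the reflected solutions, for which v ≥ 0.
    rw [← hR.encard_image]
    refine (Set.encard_le_encard ?_).trans hcard
    rintro _ ⟨_, ⟨u, ⟨hu, hua⟩, rfl⟩, rfl⟩
    refine ⟨_, _, (hu.trajectory hα hlam hL).reflect, fun x _ => ?_, rfl⟩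
    exact neg_nonneg.2 (div_nonpos_of_nonpos_of_nonneg hua.derivWithin_nonpos hs.le)
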